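/- Let $\mathcal X$ be a set of datasets with a symmetric neighbouring relation $\sim$. A mechanism $M$ assigns to each $x\in\mathcal X$ the law of a random outcome $M(x)$ in a measurable space $\mathcal Y$. It is $(\varepsilon,\delta)$-DP if $\Pr[M(x)\in S]\le e^{\varepsilon}\Pr[M(x')\in S]+\delta$ for all $x\sim x'$ and all events $S\subseteq\mathcal Y$. It is $\varepsilon$-DP if it is $(\varepsilon,0)$-DP. It is $\varepsilon$-bounded range ($\varepsilon$-BR) if $$\Pr[M(x)\in S_1]\,\Pr[M(x')\in S_2]\le e^{\varepsilon}\,\Pr[M(x)\in S_2]\,\Pr[M(x')\in S_1]$$ for all $x\sim x'$ and all events $S_1,S_2\subseteq\mathcal Y$. For $\varepsilon_g\in\mathbb R$ put $\delta_{\mathrm{opt}}(M;\varepsilon_g)=\inf\{\delta\ge 0: M\text{ is }(\varepsilon_g,\delta)\text{-DP}\}$, and for a class $\mathcal M$ of mechanisms put $\delta_{\mathrm{opt}}(\mathcal M;\varepsilon_g)=\sup_{M\in\mathcal M}\delta_{\mathrm{opt}}(M;\varepsilon_g)$. Fix $\varepsilon>0$. Let $\mathrm{BR}$ and $\mathrm{DP}$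 denote the classes of all $\varepsilon$-BR and of all $\varepsilon$-DP mechanisms. For a finite sequence $\mathcal C_1,\dots,\mathcal C_k\in\{\mathrm{BR},\mathrm{DP}\}$ fixed in advance, let $(\mathcal C_1,\dots,\mathcal C_k)$ be the class of adaptively composed mechanisms $x\mapsto(Y_1,\dots,Y_k)$ with $Y_i=M_i(x,Y_1,\dots,Y_{i-1})$, where for all values $y_1,\dots,y_{i-1}$ of the earlier outcomes the mechanism $M_i(\cdot,y_1,\dots,y_{i-1})$ belongs to $\mathcal C_i$ (and depends measurably on $y_1,\dots,y_{i-1}$). **Proposition.** Let $\varepsilon_g\ge 0$. 1. For any two finite, possibly empty, sequences $\vec{\mathcal M},\vec{\mathcal M}'$ of the classes $\mathrm{BR}$ and $\mathrm{DP}$, $$\delta_{\mathrm{opt}}(\vec{\mathcal M},\mathrm{BR},\mathrm{DP},\vec{\mathcal M}';\varepsilon_g)\le\delta_{\mathrm{opt}}(\vec{\mathcal M},\mathrm{DP},\mathrm{BR},\vec{\mathcal M}';\varepsilon_g).$$ 2. Hence, among all orderings of $m$ copies of $\mathrm{DP}$ and $n$ copies of $\mathrm{BR}$, the value of $\delta_{\mathrm{opt}}(\,\cdot\,;\varepsilon_g)$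 is largest for the ordering $(\mathrm{DP},\dots,\mathrm{DP},\mathrm{BR},\dots,\mathrm{BR})$, in which all BR mechanisms come last. -/

import Mathlib

open MeasureTheory ProbabilityTheory

universe u v

namespace PrivacyOrdering

/-- A randomized algorithm with inputs in `X`: an outcome space `Out` and, for each input `x`,
the law of the random outcome on input `x`. -/
structure Mechanism (X : Type u) where
  Out : Type v
  [measurableSpaceOut : MeasurableSpace Out]
  law : X → Measure Out
  [isProbabilityMeasure_law : ∀ x, IsProbabilityMeasure (law x)]

attribute [instance] Mechanism.measurableSpaceOut Mechanism.isProbabilityMeasure_law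

variable {X : Type u}

/-- `(ε, δ)`-differential privacy with respect to the neighbouring relation `nbr`. -/
def IsDP (nbr : X → X → Prop) (ε δ : ℝ) (M : Mechanism.{u, v} X) : Prop :=
  ∀ x x' : X, nbr x x' → ∀ S : Set M.Out, MeasurableSet S →
    (M.law x).real S ≤ Real.exp ε * (M.law x').real S + δ

/-- `ε`-bounded range. The inequality between the ratios `Pr[M(x) ∈ S] / Pr[M(x') ∈ S]` is
cross-multiplied, and it is required for events rather than for single outcomes, so that outcome
spaces need not be discrete. On a countable outcome space with measurable points this is the same
as requiring it for all pairs of single outcomes (both sides are additive in each event). -/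
def IsBR (nbr : X → X → Prop) (ε : ℝ) (M : Mechanism.{u, v} X) : Prop :=
  ∀ x x' : X, nbr x x' → ∀ S₁ S₂ : Set M.Out, MeasurableSet S₁ → MeasurableSet S₂ →
    (M.law x).real S₁ * (M.law x').real S₂ ≤
      Real.exp ε * ((M.law x).real S₂ * (M.law x').real S₁)

/-- The optimal privacy parameter of a mechanism. -/
noncomputable def deltaOpt (nbr : X → X → Prop) (M : Mechanism.{u, v} X) (εg : ℝ) : ℝ :=
  sInf {δ : ℝ | 0 ≤ δ ∧ IsDP nbr εg δ M}

/-- The optimal privacy parameter of a class of mechanisms. All values `deltaOpt nbr M εg` lie in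
`[0, 1]`, so the supremum is a genuine one for every nonempty class. -/
noncomputable def deltaOptClass (nbr : X → X → Prop) (C : Set (Mechanism.{u, v} X))
    (εg : ℝ) : ℝ :=
  sSup {δ : ℝ | ∃ M ∈ C, δ = deltaOpt nbr M εg}

/-- A mechanism that also reads a past outcome `y`, with `y` held fixed: `x ↦ M₂(x, y)`. -/
abbrev Mechanism.atOutcome {Y Z : Type v} [MeasurableSpace Y] [MeasurableSpace Z]
    (K : X → Kernel Y Z) [∀ x, IsMarkovKernel (K x)] (y : Y) : Mechanism.{u, v} X where
  Out := Z
  law x := K x y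

/-- The joint mechanism `x ↦ (M₁(x), M₂(x, M₁(x)))`, where `K x y` is the law of `M₂(x, y)`. -/
noncomputable abbrev Mechanism.andThen (M₁ : Mechanism.{u, v} X) {Z : Type v} [MeasurableSpace Z]
    (K : X → Kernel M₁.Out Z) [∀ x, IsMarkovKernel (K x)] : Mechanism.{u, v} X where
  Out := M₁.Out × Z
  law x := M₁.law x ⊗ₘ K x

/-- The class `(C₁, C₂)` of adaptively selected mechanisms: a mechanism from `C₁` is run, and
then a mechanism from `C₂` that may depend on the outcome of the first one. -/
def adaptive (C₁ C₂ : Set (Mechanism.{u, v} X)) : Set (Mechanism.{u, v} X) :=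
  {M | ∃ M₁ ∈ C₁, ∃ (Z : Type v) (_ : MeasurableSpace Z) (K : X → Kernel M₁.Out Z)
      (_ : ∀ x, IsMarkovKernel (K x)),
      (∀ y : M₁.Out, Mechanism.atOutcome K y ∈ C₂) ∧ M = M₁.andThen K}

/-- The empty interaction: a single outcome that carries no information. -/
noncomputable abbrev Mechanism.empty : Mechanism.{u, v} X where
  Out := PUnit.{v + 1}
  law _ := Measure.dirac PUnit.unit

/-- The two kinds of mechanisms in an interaction: bounded range and pure DP. -/
inductive Kind
  | BR
  | DP

/-- The class of all `ε`-BR mechanisms, respectively of all (pure) `ε`-DP mechanisms. -/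
def Kind.mechanisms (nbr : X → X → Prop) (ε : ℝ) : Kind → Set (Mechanism.{u, v} X)
  | Kind.BR => {M | IsBR nbr ε M}
  | Kind.DP => {M | IsDP nbr ε 0 M}

/-- The class `(C₁, …, C_k)` of adaptively selected mechanisms for a fixed order of kinds; the
mechanism of each round may depend on the outcomes of all earlier rounds. -/
def adaptiveSeq (nbr : X → X → Prop) (ε : ℝ) (L : List Kind) : Set (Mechanism.{u, v} X) :=
  L.foldl (fun C k => adaptive C (k.mechanisms nbr ε)) {Mechanism.empty}

end PrivacyOrdering

namespace PrivacyOrdering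

/-! Fix two distinct neighbours. The optimal parameter of a class of compositions is the value of a
dynamic program: start from the positive part `max (a - b) 0`, and let each round, read from the
last to the first, replace `V` by the supremum of `∑ V (a pᵢ) (b qᵢ)` over the pairs of outcome laws
allowed in that round (`stepValue`). The class has value `listValue` at `(1, exp εg)`, by
`deltaOptClass_le` and `le_deltaOptClass`.

For sublinear `V` the DP round is solved by randomized response, one fixed pair whatever `V`, `a`,
`b` are (`stepValue_DP`). If BR comes first, a single BR pair must serve both answers of randomized
response; if DP comes first, the BR pair may be chosen after seeing the answer. The sum of two
suprema dominates the supremum of the sum, which is `stepValue_BR_DP_le`. Monotonicity of the rounds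
carries this swap into any context, and repeated swaps sort the sequence. -/

/-- A pair of probability vectors that satisfies the constraint of a kind of mechanisms. -/
structure Kind.IsPair (k : Kind) (ε : ℝ) {ι : Type*} [Fintype ι] (p q : ι → ℝ) : Prop where
  nonneg_left : ∀ i, 0 ≤ p i
  nonneg_right : ∀ i, 0 ≤ q i
  sum_left : ∑ i, p i = 1
  sum_right : ∑ i, q i = 1
  isBR : k = Kind.BR → ∀ i j, p i * q j ≤ Real.exp ε * (p j * q i)
  isDP : k = Kind.DP → ∀ i, p i ≤ Real.exp ε * q i ∧ q i ≤ Real.exp ε * p i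

/-- Sublinear functions on the nonnegative quadrant, monotone in the first and antitone in the
second variable, and `1`-Lipschitz in each variable. -/
structure IsValue (V : ℝ → ℝ → ℝ) : Prop where
  nonneg : ∀ a b, 0 ≤ a → 0 ≤ b → 0 ≤ V a b
  smul_le : ∀ c a b, 0 ≤ c → 0 ≤ a → 0 ≤ b → V (c * a) (c * b) ≤ c * V a b
  add_le : ∀ a b a' b', 0 ≤ a → 0 ≤ b → 0 ≤ a' → 0 ≤ b' →
    V (a + a') (b + b') ≤ V a b + V a' b'
  mono : ∀ a a' b, 0 ≤ a → a ≤ a' → 0 ≤ b → V a b ≤ V a' b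
  anti : ∀ a b b', 0 ≤ a → 0 ≤ b → b ≤ b' → V a b' ≤ V a b
  lip_left : ∀ a b c, 0 ≤ a → 0 ≤ b → 0 ≤ c → V (a + c) b ≤ V a b + c
  lip_right : ∀ a b c, 0 ≤ a → 0 ≤ b → 0 ≤ c → V a b ≤ V a (b + c) + c

/-- The best value that one round of kind `k` can achieve when `V` is the value afterwards. -/
noncomputable def stepValue (ε : ℝ) (k : Kind) (V : ℝ → ℝ → ℝ) (a b : ℝ) : ℝ :=
  sSup {s | ∃ (n : ℕ) (p q : Fin n → ℝ), k.IsPair ε p q ∧ s = ∑ i, V (a * p i) (b * q i)}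

/-- The best value that a sequence of rounds can achieve when `V` is the value afterwards. -/
noncomputable def listValue (ε : ℝ) (L : List Kind) (V : ℝ → ℝ → ℝ) : ℝ → ℝ → ℝ :=
  L.foldr (stepValue ε) V

/-! ### Sublinear value functions and the one-round operator. -/

section IsValue

variable {V W : ℝ → ℝ → ℝ} {ε a b : ℝ} {k : Kind}

theorem IsValue.zero_zero (hV : IsValue V) : V 0 0 = 0 := by
  have h := hV.smul_le 0 0 0 le_rfl le_rfl le_rfl
  have h' := hV.nonneg 0 0 le_rfl le_rfl
  simp only [zero_mul] at h
  linarith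

theorem IsValue.le_left (hV : IsValue V) (ha : 0 ≤ a) (hb : 0 ≤ b) : V a b ≤ a := by
  have h := hV.lip_left 0 b a le_rfl hb ha
  have h' := hV.anti 0 0 b le_rfl le_rfl hb
  rw [hV.zero_zero] at h'
  rw [zero_add] at h
  linarith

theorem IsValue.sum_le (hV : IsValue V) {ι : Type*} (s : Finset ι) (f g : ι → ℝ)
    (hf : ∀ i, 0 ≤ f i) (hg : ∀ i, 0 ≤ g i) :
    V (∑ i ∈ s, f i) (∑ i ∈ s, g i) ≤ ∑ i ∈ s, V (f i) (g i) := by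
  classical
  induction s using Finset.induction_on with
  | empty => simp [hV.zero_zero]
  | insert i s hi ih =>
    rw [Finset.sum_insert hi, Finset.sum_insert hi, Finset.sum_insert hi]
    have := hV.add_le (f i) (g i) (∑ i ∈ s, f i) (∑ i ∈ s, g i) (hf i) (hg i)
      (Finset.sum_nonneg fun i _ => hf i) (Finset.sum_nonneg fun i _ => hg i)
    linarith

theorem IsValue.sum_le_left (hV : IsValue V) (ha : 0 ≤ a) (hb : 0 ≤ b) {ι : Type*} [Fintype ι]
    {p q : ι → ℝ} (h : k.IsPair ε p q) : ∑ i, V (a * p i) (b * q i) ≤ a := by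
  calc ∑ i, V (a * p i) (b * q i) ≤ ∑ i, a * p i := Finset.sum_le_sum fun i _ =>
        hV.le_left (mul_nonneg ha (h.nonneg_left i)) (mul_nonneg hb (h.nonneg_right i))
    _ = a := by rw [← Finset.mul_sum, h.sum_left, mul_one]

theorem Kind.IsPair.reindex {ι κ : Type*} [Fintype ι] [Fintype κ] {p q : ι → ℝ}
    (h : k.IsPair ε p q) (e : κ ≃ ι) : k.IsPair ε (p ∘ e) (q ∘ e) where
  nonneg_left i := h.nonneg_left _
  nonneg_right i := h.nonneg_right _
  sum_left := by rw [← h.sum_left]; exact e.sum_comp p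
  sum_right := by rw [← h.sum_right]; exact e.sum_comp q
  isBR hk i j := h.isBR hk _ _
  isDP hk i := h.isDP hk _

/-- The uninformative pair keeps the set under the supremum in `stepValue` nonempty, and shows that
a round never lowers the value. -/
theorem Kind.isPair_const (k : Kind) (hε : 0 ≤ ε) : k.IsPair ε (fun _ : Fin 1 => 1) fun _ => 1 where
  nonneg_left i := zero_le_one
  nonneg_right i := zero_le_one
  sum_left := by simp
  sum_right := by simp
  isBR _ i j := by simpa using hε
  isDP _ i := by simpa using hε

theorem sum_le_stepValue (hV : IsValue V) (ha : 0 ≤ a) (hb : 0 ≤ b) {ι : Type*} [Fintype ι]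
    {p q : ι → ℝ} (h : k.IsPair ε p q) :
    ∑ i, V (a * p i) (b * q i) ≤ stepValue ε k V a b := by
  have e := (Fintype.equivFin ι).symm
  -- `V a b ≤ a` and `∑ pᵢ = 1` bound the set by `a`, so the supremum is genuine.
  refine le_csSup ⟨a, ?_⟩ ⟨_, _, _, h.reindex e, ?_⟩
  · rintro _ ⟨n, p, q, h, rfl⟩
    exact hV.sum_le_left ha hb h
  · exact (e.sum_comp fun i => V (a * p i) (b * q i)).symm

theorem stepValue_le (hε : 0 ≤ ε) {s : ℝ} (h : ∀ (n : ℕ) (p q : Fin n → ℝ), k.IsPair ε p q →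
    ∑ i, V (a * p i) (b * q i) ≤ s) : stepValue ε k V a b ≤ s := by
  refine csSup_le ⟨_, _, _, _, k.isPair_const hε, rfl⟩ ?_
  rintro _ ⟨n, p, q, hpq, rfl⟩
  exact h n p q hpq

theorem exists_lt_sum_of_lt_stepValue (hε : 0 ≤ ε) {s : ℝ} (h : s < stepValue ε k V a b) :
    ∃ (n : ℕ) (p q : Fin n → ℝ), k.IsPair ε p q ∧ s < ∑ i, V (a * p i) (b * q i) := by
  by_contra! hn
  exact absurd (stepValue_le hε hn) (not_le.2 h)

theorem stepValue_mono (hε : 0 ≤ ε) (hW : IsValue W)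
    (h : ∀ a b, 0 ≤ a → 0 ≤ b → V a b ≤ W a b) (ha : 0 ≤ a) (hb : 0 ≤ b) :
    stepValue ε k V a b ≤ stepValue ε k W a b :=
  stepValue_le hε fun _ _ _ hpq => (Finset.sum_le_sum fun i _ => h _ _
    (mul_nonneg ha (hpq.nonneg_left i)) (mul_nonneg hb (hpq.nonneg_right i))).trans
    (sum_le_stepValue hW ha hb hpq)

/-- Each property passes through the sum term by term and survives the supremum; the Lipschitz
constants stay `1` because `p` and `q` have total mass `1`. -/
theorem IsValue.stepValue (hε : 0 ≤ ε) (hV : IsValue V) (k : Kind) :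
    IsValue (stepValue ε k V) where
  nonneg a b ha hb := by
    have h := sum_le_stepValue hV ha hb (k.isPair_const hε)
    simp only [mul_one, Finset.univ_unique, Finset.sum_const, Finset.card_singleton, one_smul] at h
    exact (hV.nonneg a b ha hb).trans h
  smul_le c a b hc ha hb := by
    refine stepValue_le hε fun n p q h => ?_
    refine le_trans ?_ (mul_le_mul_of_nonneg_left (sum_le_stepValue hV ha hb h) hc)
    rw [Finset.mul_sum]
    refine Finset.sum_le_sum fun i _ => ?_
    rw [mul_assoc, mul_assoc]
    exact hV.smul_le _ _ _ hc (mul_nonneg ha (h.nonneg_left i)) (mul_nonneg hb (h.nonneg_right i))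
  add_le a b a' b' ha hb ha' hb' := by
    refine stepValue_le hε fun n p q h => ?_
    refine le_trans ?_ (add_le_add (sum_le_stepValue hV ha hb h) (sum_le_stepValue hV ha' hb' h))
    rw [← Finset.sum_add_distrib]
    refine Finset.sum_le_sum fun i _ => ?_
    have hp := h.nonneg_left i
    have hq := h.nonneg_right i
    rw [add_mul, add_mul]
    apply hV.add_le <;> positivity
  mono a a' b ha haa' hb := by
    refine stepValue_le hε fun n p q h => ?_
    refine le_trans ?_ (sum_le_stepValue hV (ha.trans haa') hb h)
    refine Finset.sum_le_sum fun i _ => ?_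
    have hp := h.nonneg_left i
    have hq := h.nonneg_right i
    exact hV.mono _ _ _ (by positivity) (by gcongr) (by positivity)
  anti a b b' ha hb hbb' := by
    refine stepValue_le hε fun n p q h => ?_
    refine le_trans ?_ (sum_le_stepValue hV ha hb h)
    refine Finset.sum_le_sum fun i _ => ?_
    have hp := h.nonneg_left i
    have hq := h.nonneg_right i
    exact hV.anti _ _ _ (by positivity) (by positivity) (by gcongr)
  lip_left a b c ha hb hc := by
    refine stepValue_le hε fun n p q h => ?_
    have hs : ∑ i, c * p i = c := by rw [← Finset.mul_sum, h.sum_left, mul_one]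
    have hle : ∑ i, V ((a + c) * p i) (b * q i) ≤ ∑ i, (V (a * p i) (b * q i) + c * p i) := by
      refine Finset.sum_le_sum fun i _ => ?_
      have hp := h.nonneg_left i
      have hq := h.nonneg_right i
      rw [add_mul]
      apply hV.lip_left <;> positivity
    rw [Finset.sum_add_distrib, hs] at hle
    have := sum_le_stepValue hV ha hb h
    linarith
  lip_right a b c ha hb hc := by
    refine stepValue_le hε fun n p q h => ?_
    have hs : ∑ i, c * q i = c := by rw [← Finset.mul_sum, h.sum_right, mul_one]
    have hle : ∑ i, V (a * p i) (b * q i) ≤ ∑ i, (V (a * p i) ((b + c) * q i) + c * q i) := by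
      refine Finset.sum_le_sum fun i _ => ?_
      have hp := h.nonneg_left i
      have hq := h.nonneg_right i
      rw [add_mul]
      apply hV.lip_right <;> positivity
    rw [Finset.sum_add_distrib, hs] at hle
    have := sum_le_stepValue hV ha (add_nonneg hb hc) h
    linarith

theorem IsValue.listValue (hε : 0 ≤ ε) (hV : IsValue V) (L : List Kind) :
    IsValue (listValue ε L V) := by
  induction L with
  | nil => exact hV
  | cons k L ih => exact ih.stepValue hε k

theorem listValue_append (L L' : List Kind) :
    listValue ε (L ++ L') V = listValue ε L (listValue ε L' V) :=
  List.foldr_append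

theorem listValue_mono (hε : 0 ≤ ε) (hW : IsValue W)
    (h : ∀ a b, 0 ≤ a → 0 ≤ b → V a b ≤ W a b) (L : List Kind) :
    ∀ a b, 0 ≤ a → 0 ≤ b → listValue ε L V a b ≤ listValue ε L W a b := by
  induction L with
  | nil => exact h
  | cons k L ih => exact fun a b ha hb => stepValue_mono hε (hW.listValue hε L) ih ha hb

/-! ### Exchanging adjacent rounds and sorting. -/

/-- Randomized response is optimal among the pure DP mechanisms. -/
theorem stepValue_DP (hε : 0 < ε) (hV : IsValue V) (ha : 0 ≤ a) (hb : 0 ≤ b) :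
    stepValue ε Kind.DP V a b =
      (V (a * Real.exp ε) b + V a (b * Real.exp ε)) / (1 + Real.exp ε) := by
  have he : 1 < Real.exp ε := Real.one_lt_exp_iff.2 hε
  generalize hE : Real.exp ε = E at he ⊢
  have hE1 : 0 < E - 1 := by linarith
  apply le_antisymm
  · refine stepValue_le hε.le fun n p q h => ?_
    -- `(pᵢ, qᵢ)` is a combination of `(E, 1)` and `(1, E)` with coefficients `(E pᵢ - qᵢ) / (E² -
    -- 1)` and `(E qᵢ - pᵢ) / (E² - 1)`, which are nonnegative exactly by the DP constraint.
    -- Sublinearity does the rest.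
    have key : ∀ i, V (a * p i) (b * q i) ≤
        (E * p i - q i) / (E - 1) * (V (a * E) b / (1 + E)) +
          (E * q i - p i) / (E - 1) * (V a (b * E) / (1 + E)) := by
      intro i
      have hpq := h.isDP rfl i
      rw [hE] at hpq
      have hu : 0 ≤ (E * p i - q i) / (E - 1) / (1 + E) :=
        div_nonneg (div_nonneg (by linarith) hE1.le) (by linarith)
      have hv : 0 ≤ (E * q i - p i) / (E - 1) / (1 + E) :=
        div_nonneg (div_nonneg (by linarith) hE1.le) (by linarith)
      have haE : 0 ≤ a * E := by positivity
      have hbE : 0 ≤ b * E := by positivity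
      have h1 := hV.smul_le _ _ _ hu haE hb
      have h2 := hV.smul_le _ _ _ hv ha hbE
      have h3 := hV.add_le _ _ _ _ (mul_nonneg hu haE) (mul_nonneg hu hb) (mul_nonneg hv ha)
        (mul_nonneg hv hbE)
      have e1 : (E * p i - q i) / (E - 1) / (1 + E) * (a * E) +
          (E * q i - p i) / (E - 1) / (1 + E) * a = a * p i := by
        field_simp
        ring
      have e2 : (E * p i - q i) / (E - 1) / (1 + E) * b +
          (E * q i - p i) / (E - 1) / (1 + E) * (b * E) = b * q i := by
        field_simp
        ring
      rw [e1, e2] at h3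
      refine (h3.trans (add_le_add h1 h2)).trans (le_of_eq ?_)
      ring
    -- Both families of weights, with denominator `E - 1`, sum to `1`.
    refine (Finset.sum_le_sum fun i _ => key i).trans (le_of_eq ?_)
    rw [Finset.sum_add_distrib, ← Finset.sum_mul, ← Finset.sum_mul, ← Finset.sum_div,
      ← Finset.sum_div, Finset.sum_sub_distrib, Finset.sum_sub_distrib, ← Finset.mul_sum,
      ← Finset.mul_sum, h.sum_left, h.sum_right]
    field_simp
  · have hpair : Kind.DP.IsPair ε (fun i : Bool => cond i (E / (1 + E)) (1 / (1 + E)))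
        (fun i : Bool => cond i (1 / (1 + E)) (E / (1 + E))) := by
      constructor
      · rintro (_ | _) <;> simp only [cond_true, cond_false] <;> positivity
      · rintro (_ | _) <;> simp only [cond_true, cond_false] <;> positivity
      · simp only [Fintype.sum_bool, cond_true, cond_false]
        field_simp
        ring
      · simp only [Fintype.sum_bool, cond_true, cond_false]
        field_simp
      · intro h
        cases h
      · rw [hE]
        rintro - (_ | _) <;> simp only [cond_true, cond_false] <;> constructor <;>
          rw [← mul_div_assoc] <;> gcongr <;> nlinarith
    have h := sum_le_stepValue hV ha hb hpair
    simp only [Fintype.sum_bool, cond_true, cond_false] at h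
    refine le_trans ?_ h
    -- Scaling by `1 + E` turns the two masses of randomized response into `E` and `1`.
    have h1 := hV.smul_le (1 + E) (a * (E / (1 + E))) (b * (1 / (1 + E))) (by linarith)
      (by positivity) (by positivity)
    have h2 := hV.smul_le (1 + E) (a * (1 / (1 + E))) (b * (E / (1 + E))) (by linarith)
      (by positivity) (by positivity)
    have e1 : ∀ c : ℝ, (1 + E) * (c * (E / (1 + E))) = c * E := fun c => by field_simp
    have e2 : ∀ c : ℝ, (1 + E) * (c * (1 / (1 + E))) = c := fun c => by field_simp
    rw [e1, e2] at h1 h2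
    rw [div_le_iff₀ (by linarith)]
    linarith

/-- After expanding both DP rounds, the left side uses the same `(p, q)` at `(a E, b)` and at `(a, b
E)`, while the right side optimizes the two separately. -/
theorem stepValue_BR_DP_le (hε : 0 < ε) (hV : IsValue V) (ha : 0 ≤ a) (hb : 0 ≤ b) :
    stepValue ε Kind.BR (stepValue ε Kind.DP V) a b ≤
      stepValue ε Kind.DP (stepValue ε Kind.BR V) a b := by
  rw [stepValue_DP hε (hV.stepValue hε.le _) ha hb]
  refine stepValue_le hε.le fun n p q h => ?_
  have haE : 0 ≤ a * Real.exp ε := by positivity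
  have hbE : 0 ≤ b * Real.exp ε := by positivity
  refine le_trans (le_of_eq ?_) (div_le_div_of_nonneg_right (add_le_add
    (sum_le_stepValue hV haE hb h) (sum_le_stepValue hV ha hbE h)) (by positivity))
  rw [← Finset.sum_add_distrib, Finset.sum_div]
  refine Finset.sum_congr rfl fun i _ => ?_
  rw [stepValue_DP hε hV (mul_nonneg ha (h.nonneg_left i)) (mul_nonneg hb (h.nonneg_right i)),
    mul_right_comm a, mul_right_comm b]

theorem listValue_BR_DP_le (hε : 0 < ε) (hV : IsValue V) (L L' : List Kind) (ha : 0 ≤ a)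
    (hb : 0 ≤ b) :
    listValue ε (L ++ [Kind.BR, Kind.DP] ++ L') V a b ≤
      listValue ε (L ++ [Kind.DP, Kind.BR] ++ L') V a b := by
  simp only [listValue_append]
  have hL' := hV.listValue hε.le L'
  exact listValue_mono hε.le ((hL'.stepValue hε.le Kind.BR).stepValue hε.le Kind.DP)
    (fun a b ha hb => stepValue_BR_DP_le hε hL' ha hb) L a b ha hb

theorem listValue_BR_replicate_le (hε : 0 < ε) (hV : IsValue V) (m : ℕ) :
    ∀ a b, 0 ≤ a → 0 ≤ b → stepValue ε Kind.BR (listValue ε (List.replicate m Kind.DP) V) a b ≤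
      listValue ε (List.replicate m Kind.DP) (stepValue ε Kind.BR V) a b := by
  induction m with
  | zero => exact fun a b _ _ => le_rfl
  | succ m ih =>
    intro a b ha hb
    exact (stepValue_BR_DP_le hε (hV.listValue hε.le _) ha hb).trans
      (stepValue_mono hε.le ((hV.stepValue hε.le _).listValue hε.le _) ih ha hb)

/-- Insertion sort: once the tail is sorted, a leading DP is in place and a leading BR is moved past
the block of DP rounds. -/
theorem listValue_le_sorted (hε : 0 < ε) (hV : IsValue V) {m n : ℕ} {L : List Kind}
    (hL : L.Perm (List.replicate m Kind.DP ++ List.replicate n Kind.BR)) :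
    ∀ a b, 0 ≤ a → 0 ≤ b → listValue ε L V a b ≤
      listValue ε (List.replicate m Kind.DP ++ List.replicate n Kind.BR) V a b := by
  induction L generalizing m n with
  | nil =>
    rw [← hL.symm.eq_nil]
    exact fun a b _ _ => le_rfl
  | cons k L ih =>
    have hk : k ∈ List.replicate m Kind.DP ++ List.replicate n Kind.BR :=
      hL.subset List.mem_cons_self
    cases k with
    | DP =>
      obtain _ | m := m
      · simp at hk
      have hL' : L.Perm (List.replicate m Kind.DP ++ List.replicate n Kind.BR) := by
        simpa [List.replicate_succ] using hL
      exact fun a b ha hb => stepValue_mono hε.le (hV.listValue hε.le _) (ih hL') ha hb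
    | BR =>
      obtain _ | n := n
      · simp at hk
      have hL' : L.Perm (List.replicate m Kind.DP ++ List.replicate n Kind.BR) := by
        rw [List.replicate_succ] at hL
        exact (hL.trans List.perm_middle).cons_inv
      intro a b ha hb
      have h := stepValue_mono (k := Kind.BR) hε.le (hV.listValue hε.le _) (ih hL') ha hb
      rw [listValue_append] at h ⊢
      exact h.trans (listValue_BR_replicate_le hε (hV.listValue hε.le _) m a b ha hb)

/-- The terminal value: summed over outcomes with `b` scaled by `exp εg`, it is the hockey-stick
divergence. -/
theorem isValue_max : IsValue fun a b => max (a - b) 0 where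
  nonneg a b _ _ := le_max_right _ _
  smul_le c a b hc _ _ := by
    rw [← mul_sub, mul_max_of_nonneg _ _ hc, mul_zero]
  add_le a b a' b' _ _ _ _ := by
    have := le_max_left (a - b) 0
    have := le_max_right (a - b) 0
    have := le_max_left (a' - b') 0
    have := le_max_right (a' - b') 0
    apply max_le <;> linarith
  mono a a' b _ h _ := by gcongr
  anti a b b' _ _ h := by gcongr
  lip_left a b c _ _ hc := by
    have := le_max_left (a - b) 0
    have := le_max_right (a - b) 0
    apply max_le <;> linarith
  lip_right a b c _ _ hc := by
    have := le_max_left (a - (b + c)) 0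
    have := le_max_right (a - (b + c)) 0
    apply max_le <;> linarith

end IsValue

variable {X : Type u} {nbr : X → X → Prop} {ε : ℝ}

theorem adaptiveSeq_concat (L : List Kind) (k : Kind) :
    adaptiveSeq.{u, v} nbr ε (L ++ [k]) =
      adaptive (adaptiveSeq nbr ε L) (k.mechanisms nbr ε) := by
  simp only [adaptiveSeq, List.foldl_append, List.foldl_cons, List.foldl_nil]

/-! ### Upper bound -/

theorem sum_real_preimage_eq_one {Y ι : Type*} [MeasurableSpace Y] [MeasurableSpace ι]
    [MeasurableSingletonClass ι] [Fintype ι] (P : Measure Y) [IsProbabilityMeasure P] {φ : Y → ι}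
    (hφ : Measurable φ) : ∑ i, P.real (φ ⁻¹' {i}) = 1 := by
  have h := sum_measureReal_preimage_singleton (μ := P) (f := φ) Finset.univ
    fun i _ => hφ (measurableSet_singleton i)
  rw [h]
  simp

theorem Kind.isPair_of_mem_mechanisms (hsymm : ∀ x x', nbr x x' → nbr x' x) {k : Kind}
    {M : Mechanism.{u, v} X} (hM : M ∈ k.mechanisms nbr ε) {x x' : X} (hx : nbr x x')
    {ι : Type*} [MeasurableSpace ι] [MeasurableSingletonClass ι] [Fintype ι] {φ : M.Out → ι}
    (hφ : Measurable φ) :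
    k.IsPair ε (fun i => (M.law x).real (φ ⁻¹' {i})) fun i => (M.law x').real (φ ⁻¹' {i}) where
  nonneg_left i := measureReal_nonneg
  nonneg_right i := measureReal_nonneg
  sum_left := sum_real_preimage_eq_one _ hφ
  sum_right := sum_real_preimage_eq_one _ hφ
  isBR hk i j := by
    subst hk
    exact hM x x' hx _ _ (hφ (measurableSet_singleton i)) (hφ (measurableSet_singleton j))
  isDP hk i := by
    subst hk
    have h1 := hM x x' hx _ (hφ (measurableSet_singleton i))
    have h2 := hM x' x (hsymm _ _ hx) _ (hφ (measurableSet_singleton i))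
    rw [add_zero] at h1 h2
    exact ⟨h1, h2⟩

/-- Finitely many measurable functions with values in `[0, 1]` are, up to a given precision,
constant on the cells of a finite measurable partition. -/
theorem exists_finite_partition {Y ι : Type*} [MeasurableSpace Y] [Fintype ι] {f : ι → Y → ℝ}
    (hf : ∀ i, Measurable (f i)) (h0 : ∀ i y, 0 ≤ f i y) (h1 : ∀ i y, f i y ≤ 1) {η : ℝ}
    (hη : 0 < η) :
    ∃ (n : ℕ) (ψ : Y → ι → Fin n), Measurable ψ ∧
      ∀ y y', ψ y = ψ y' → ∀ i, f i y ≤ f i y' + η := by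
  -- Cells come from rounding every `f i` down to the grid of mesh `η`.
  refine ⟨⌊1 / η⌋₊ + 1, fun y i => ⟨⌊f i y / η⌋₊, Nat.lt_succ_of_le (Nat.floor_mono ?_)⟩, ?_, ?_⟩
  · have := h1 i y
    gcongr
  · refine measurable_pi_lambda _ fun i => ?_
    refine measurable_to_countable' fun m => ?_
    have : (fun y => (⟨⌊f i y / η⌋₊, Nat.lt_succ_of_le (Nat.floor_mono (by
        have := h1 i y
        gcongr))⟩ : Fin (⌊1 / η⌋₊ + 1))) ⁻¹' {m} = (fun y => ⌊f i y / η⌋₊) ⁻¹' {(m : ℕ)} := by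
      ext y
      simp [Fin.ext_iff]
    rw [this]
    exact (Nat.measurable_floor.comp ((hf i).div_const η)) (measurableSet_singleton _)
  · intro y y' h i
    have h2 : ⌊f i y / η⌋₊ = ⌊f i y' / η⌋₊ := congrArg Fin.val (congrFun h i)
    have h3 : f i y / η < ⌊f i y / η⌋₊ + 1 := Nat.lt_floor_add_one _
    have h4 : (⌊f i y' / η⌋₊ : ℝ) ≤ f i y' / η := Nat.floor_le (div_nonneg (h0 i y') hη.le)
    rw [h2] at h3
    have h5 : f i y / η < f i y' / η + 1 := by linarith
    rw [div_add_one hη.ne', div_lt_div_iff_of_pos_right hη] at h5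
    exact h5.le

theorem integral_comp_eq_sum {Y κ : Type*} [MeasurableSpace Y] [MeasurableSpace κ]
    [MeasurableSingletonClass κ] [Fintype κ] (P : Measure Y) [IsProbabilityMeasure P] {ψ : Y → κ}
    (hψ : Measurable ψ) (h : κ → ℝ) : ∫ y, h (ψ y) ∂P = ∑ j, h j * P.real (ψ ⁻¹' {j}) := by
  have := Measure.isProbabilityMeasure_map (μ := P) hψ.aemeasurable
  rw [← integral_map hψ.aemeasurable (measurable_of_countable h).aestronglyMeasurable,
    integral_fintype (Integrable.of_finite)]
  refine Finset.sum_congr rfl fun j _ => ?_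
  rw [map_measureReal_apply hψ (measurableSet_singleton j), smul_eq_mul, mul_comm]

theorem measureReal_compProd {Y Z : Type*} [MeasurableSpace Y] [MeasurableSpace Z] (P : Measure Y)
    [IsProbabilityMeasure P] (K : Kernel Y Z) [IsMarkovKernel K] {s : Set (Y × Z)}
    (hs : MeasurableSet s) : (P ⊗ₘ K).real s = ∫ y, (K y).real (Prod.mk y ⁻¹' s) ∂P := by
  rw [measureReal_def, Measure.compProd_apply hs]
  simp only [measureReal_def]
  rw [integral_toReal (Kernel.measurable_kernel_prodMk_left hs).aemeasurable
    (Filter.Eventually.of_forall fun y => measure_lt_top _ _)]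

/-- The last round of kind `k` improves the value by at most `stepValue`. -/
theorem sum_compProd_le {Y Z : Type*} [MeasurableSpace Y] [MeasurableSpace Z] {V : ℝ → ℝ → ℝ}
    (hV : IsValue V) {k : Kind} {g c : ℝ} (hg : 0 ≤ g)
    (P Q : Measure Y) [IsProbabilityMeasure P] [IsProbabilityMeasure Q]
    (K K' : Kernel Y Z) [IsMarkovKernel K] [IsMarkovKernel K']
    {ι : Type} [MeasurableSpace ι] [MeasurableSingletonClass ι] [Fintype ι] {φ : Y × Z → ι}
    (hφ : Measurable φ)
    (hK : ∀ y, k.IsPair ε (fun i => (K y).real (Prod.mk y ⁻¹' (φ ⁻¹' {i})))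
      fun i => (K' y).real (Prod.mk y ⁻¹' (φ ⁻¹' {i})))
    (hc : ∀ (κ : Type) [MeasurableSpace κ] [MeasurableSingletonClass κ] [Fintype κ] (ψ : Y → κ),
      Measurable ψ →
        ∑ j, stepValue ε k V (P.real (ψ ⁻¹' {j})) (g * Q.real (ψ ⁻¹' {j})) ≤ c) :
    ∑ i, V ((P ⊗ₘ K).real (φ ⁻¹' {i})) (g * (Q ⊗ₘ K').real (φ ⁻¹' {i})) ≤ c := by
  refine le_of_forall_pos_le_add fun e he => ?_
  -- Each outcome in `ι` will cost an error `(1 + g) * η`.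
  obtain ⟨η, hη, hηe⟩ : ∃ η > 0, Fintype.card ι * ((1 + g) * η) ≤ e := by
    have hd : 0 < Fintype.card ι * (1 + g) + 1 := by positivity
    refine ⟨e / (Fintype.card ι * (1 + g) + 1), by positivity, ?_⟩
    rw [← mul_assoc, ← mul_div_assoc, div_le_iff₀ hd]
    nlinarith
  have hs : ∀ i, MeasurableSet (φ ⁻¹' {i}) := fun i => hφ (measurableSet_singleton i)
  have hmeas : ∀ (K : Kernel Y Z) [IsMarkovKernel K] i,
      Measurable fun y => (K y).real (Prod.mk y ⁻¹' (φ ⁻¹' {i})) := fun K _ i =>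
    (Kernel.measurable_kernel_prodMk_left (hs i)).ennreal_toReal
  have hint : ∀ (P : Measure Y) [IsProbabilityMeasure P] (K : Kernel Y Z) [IsMarkovKernel K] i,
      Integrable (fun y => (K y).real (Prod.mk y ⁻¹' (φ ⁻¹' {i}))) P := fun P _ K _ i =>
    Integrable.of_bound (hmeas K i).aestronglyMeasurable 1 (Filter.Eventually.of_forall fun y => by
      rw [Real.norm_eq_abs, abs_of_nonneg measureReal_nonneg]
      exact measureReal_le_one)
  obtain ⟨n, ψ, hψ, hψη⟩ := exists_finite_partition
    (f := Sum.elim (fun i y => (K y).real (Prod.mk y ⁻¹' (φ ⁻¹' {i})))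
      fun i y => (K' y).real (Prod.mk y ⁻¹' (φ ⁻¹' {i})))
    (by rintro (i | i) <;> exact hmeas _ i)
    (by rintro (i | i) y <;> exact measureReal_nonneg)
    (by rintro (i | i) y <;> exact measureReal_le_one) hη
  have hYne : Nonempty Y := nonempty_of_isProbabilityMeasure P
  classical
  -- A point of each cell, at which both kernels are frozen. On empty cells it is arbitrary, which
  -- is harmless since `hK` holds everywhere.
  set rep := Function.invFun ψ with hrep
  have hψrep : ∀ y, ψ (rep (ψ y)) = ψ y := fun y => Function.invFun_eq ⟨y, rfl⟩
  set p : ((ι ⊕ ι) → Fin n) → ι → ℝ := fun j i => (K (rep j)).real (Prod.mk (rep j) ⁻¹' (φ ⁻¹' {i}))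
    with hp
  set q : ((ι ⊕ ι) → Fin n) → ι → ℝ :=
    fun j i => (K' (rep j)).real (Prod.mk (rep j) ⁻¹' (φ ⁻¹' {i})) with hq
  have hpair : ∀ j, k.IsPair ε (p j) (q j) := fun j => hK (rep j)
  have hP : ∀ i, (P ⊗ₘ K).real (φ ⁻¹' {i}) ≤ ∑ j, p j i * P.real (ψ ⁻¹' {j}) + η := by
    intro i
    have h1 : ∫ y, (K y).real (Prod.mk y ⁻¹' (φ ⁻¹' {i})) ∂P ≤ ∫ y, (p (ψ y) i + η) ∂P :=
      integral_mono (hint P K i) (Integrable.of_finite (μ := P.map ψ)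
        (f := fun j => p j i + η) |>.comp_measurable hψ) fun y =>
        hψη y (rep (ψ y)) (hψrep y).symm (Sum.inl i)
    rw [measureReal_compProd P K (hs i)]
    refine h1.trans (le_of_eq ?_)
    rw [integral_comp_eq_sum P hψ fun j => p j i + η]
    simp only [add_mul]
    rw [Finset.sum_add_distrib, ← Finset.mul_sum, sum_real_preimage_eq_one P hψ, mul_one]
  have hQ : ∀ i, ∑ j, q j i * Q.real (ψ ⁻¹' {j}) ≤ (Q ⊗ₘ K').real (φ ⁻¹' {i}) + η := by
    intro i
    have h1 : ∫ y, (q (ψ y) i - η) ∂Q ≤ ∫ y, (K' y).real (Prod.mk y ⁻¹' (φ ⁻¹' {i})) ∂Q :=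
      integral_mono (Integrable.of_finite (μ := Q.map ψ)
        (f := fun j => q j i - η) |>.comp_measurable hψ) (hint Q K' i) fun y =>
        sub_le_iff_le_add.2 (hψη (rep (ψ y)) y (hψrep y) (Sum.inr i))
    rw [measureReal_compProd Q K' (hs i), ← sub_le_iff_le_add]
    refine le_trans (le_of_eq ?_) h1
    rw [integral_comp_eq_sum Q hψ fun j => q j i - η]
    simp only [sub_mul]
    rw [Finset.sum_sub_distrib, ← Finset.mul_sum, sum_real_preimage_eq_one Q hψ, mul_one]
  -- The Lipschitz bounds absorb the freezing errors, `η` on the left and `g * η` on the right;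
  -- subadditivity then splits the value over the cells.
  have key : ∀ i, V ((P ⊗ₘ K).real (φ ⁻¹' {i})) (g * (Q ⊗ₘ K').real (φ ⁻¹' {i})) ≤
      ∑ j, V (P.real (ψ ⁻¹' {j}) * p j i) (g * Q.real (ψ ⁻¹' {j}) * q j i) + (1 + g) * η := by
    intro i
    have hA : 0 ≤ ∑ j, p j i * P.real (ψ ⁻¹' {j}) := Finset.sum_nonneg fun j _ =>
      mul_nonneg ((hpair j).nonneg_left i) measureReal_nonneg
    have hB : 0 ≤ ∑ j, q j i * Q.real (ψ ⁻¹' {j}) := Finset.sum_nonneg fun j _ =>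
      mul_nonneg ((hpair j).nonneg_right i) measureReal_nonneg
    have hb : 0 ≤ g * (Q ⊗ₘ K').real (φ ⁻¹' {i}) := mul_nonneg hg measureReal_nonneg
    have h1 := hV.mono _ _ _ measureReal_nonneg (hP i) hb
    have h2 := hV.lip_left _ _ _ hA hb hη.le
    have h3 := hV.lip_right _ _ _ hA hb (mul_nonneg hg hη.le)
    have h4 := hV.anti _ _ _ hA (mul_nonneg hg hB)
      ((mul_le_mul_of_nonneg_left (hQ i) hg).trans_eq (mul_add _ _ _))
    have h5 := hV.sum_le Finset.univ (fun j => P.real (ψ ⁻¹' {j}) * p j i)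
      (fun j => g * Q.real (ψ ⁻¹' {j}) * q j i)
      (fun j => mul_nonneg measureReal_nonneg ((hpair j).nonneg_left i))
      (fun j => mul_nonneg (mul_nonneg hg measureReal_nonneg) ((hpair j).nonneg_right i))
    have e1 : ∑ j, P.real (ψ ⁻¹' {j}) * p j i = ∑ j, p j i * P.real (ψ ⁻¹' {j}) :=
      Finset.sum_congr rfl fun j _ => mul_comm _ _
    have e2 : ∑ j, g * Q.real (ψ ⁻¹' {j}) * q j i = g * ∑ j, q j i * Q.real (ψ ⁻¹' {j}) := by
      rw [Finset.mul_sum]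
      exact Finset.sum_congr rfl fun j _ => by ring
    rw [e1, e2] at h5
    linarith
  have hsum := Finset.sum_le_sum fun i (_ : i ∈ Finset.univ) => key i
  rw [Finset.sum_add_distrib, Finset.sum_comm, Finset.sum_const, nsmul_eq_mul,
    Finset.card_univ] at hsum
  have hstep := Finset.sum_le_sum fun j (_ : j ∈ Finset.univ) => sum_le_stepValue hV
    (measureReal_nonneg (μ := P) (s := ψ ⁻¹' {j}))
    (mul_nonneg hg (measureReal_nonneg (μ := Q) (s := ψ ⁻¹' {j}))) (hpair j)
  have := hc _ ψ hψ
  linarith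

/-- Induction removes the last round and absorbs it into `V`, so `V` must be general. So must the
finite observation `φ`: the partition from `sum_compProd_le` becomes the observation of the earlier
rounds. -/
theorem sum_le_listValue (hsymm : ∀ x x', nbr x x' → nbr x' x) (hε : 0 ≤ ε) {g : ℝ} (hg : 0 ≤ g)
    {x x' : X} (hx : nbr x x') (L : List Kind) :
    ∀ {V : ℝ → ℝ → ℝ}, IsValue V → ∀ M ∈ adaptiveSeq.{u, v} nbr ε L,
      ∀ (ι : Type) [MeasurableSpace ι] [MeasurableSingletonClass ι] [Fintype ι] (φ : M.Out → ι),
        Measurable φ →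
          ∑ i, V ((M.law x).real (φ ⁻¹' {i})) (g * (M.law x').real (φ ⁻¹' {i})) ≤
            listValue ε L V 1 g := by
  induction L using List.reverseRecOn with
  | nil =>
    rintro V hV _ rfl ι _ _ _ φ hφ
    classical
    refine le_of_eq ?_
    have h : ∀ i, (Measure.dirac PUnit.unit).real (φ ⁻¹' {i}) =
        if i = φ PUnit.unit then 1 else 0 := by
      intro i
      rw [measureReal_def, Measure.dirac_apply' _ (hφ (measurableSet_singleton i))]
      by_cases hi : i = φ PUnit.unit
      · simp [hi]
      · have : PUnit.unit ∉ φ ⁻¹' {i} := fun h => hi (Eq.symm h)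
        simp [hi, this]
    simp only [h]
    rw [Finset.sum_eq_single (φ PUnit.unit)]
    · simp [listValue]
    · intro i _ hi
      simp [hi, hV.zero_zero]
    · simp
  | append_singleton L k ih =>
    intro V hV M hM ι _ _ _ φ hφ
    rw [adaptiveSeq_concat] at hM
    obtain ⟨M₁, hM₁, Z, _, K, _, hK, rfl⟩ := hM
    rw [listValue_append]
    refine sum_compProd_le (ε := ε) (k := k) hV hg (M₁.law x) (M₁.law x') (K x) (K x') hφ
      (fun y => ?_) fun κ _ _ _ ψ hψ => ih (hV.stepValue hε k) M₁ hM₁ κ ψ hψ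
    exact Kind.isPair_of_mem_mechanisms hsymm (hK y) hx (φ := fun z => φ (y, z))
      (hφ.comp measurable_prodMk_left)

/-! ### Lower bound -/

/-- The measure with point masses `w z` on a finite space. -/
noncomputable def weightMeasure {Z : Type*} [Fintype Z] [MeasurableSpace Z] (w : Z → ℝ) :
    Measure Z :=
  ∑ z, ENNReal.ofReal (w z) • Measure.dirac z

section weightMeasure

variable {Z : Type*} [Fintype Z] [MeasurableSpace Z] {w : Z → ℝ}

open scoped Classical in
theorem weightMeasure_real_apply (h0 : ∀ z, 0 ≤ w z) {S : Set Z} (hS : MeasurableSet S) :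
    (weightMeasure w).real S = ∑ z with z ∈ S, w z := by
  rw [measureReal_def, weightMeasure, Measure.finsetSum_apply, ENNReal.toReal_sum,
    Finset.sum_filter]
  · refine Finset.sum_congr rfl fun z _ => ?_
    by_cases hz : z ∈ S <;> simp [Measure.dirac_apply' _ hS, hz, h0 z]
  · intro z _
    rw [Measure.smul_apply, smul_eq_mul]
    exact ENNReal.mul_ne_top ENNReal.ofReal_ne_top (measure_ne_top _ _)

theorem isProbabilityMeasure_weightMeasure (h0 : ∀ z, 0 ≤ w z) (h1 : ∑ z, w z = 1) :
    IsProbabilityMeasure (weightMeasure w) := by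
  constructor
  rw [weightMeasure, Measure.finsetSum_apply]
  simp only [Measure.smul_apply, smul_eq_mul, measure_univ, mul_one]
  rw [← ENNReal.ofReal_sum_of_nonneg fun z _ => h0 z, h1, ENNReal.ofReal_one]

theorem weightMeasure_real_singleton [MeasurableSingletonClass Z] (h0 : ∀ z, 0 ≤ w z) (z : Z) :
    (weightMeasure w).real {z} = w z := by
  classical
  rw [weightMeasure_real_apply h0 (measurableSet_singleton z)]
  simp [Finset.sum_filter]

end weightMeasure

theorem Kind.mem_mechanisms_of_isPair {k : Kind} (M : Mechanism.{u, v} X) [Fintype M.Out]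
    {w : X → M.Out → ℝ} (hM : ∀ x, M.law x = weightMeasure (w x))
    (h : ∀ x x', k.IsPair ε (w x) (w x')) : M ∈ k.mechanisms nbr ε := by
  classical
  have h0 : ∀ x z, 0 ≤ w x z := fun x => (h x x).nonneg_left
  cases k with
  | BR =>
    intro x x' _ S₁ S₂ hS₁ hS₂
    simp only [hM, weightMeasure_real_apply (h0 _) hS₁, weightMeasure_real_apply (h0 _) hS₂]
    rw [Finset.sum_mul_sum, Finset.sum_mul_sum, Finset.sum_comm (s := Finset.univ.filter (· ∈ S₂)),
      Finset.mul_sum]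
    refine Finset.sum_le_sum fun i _ => ?_
    rw [Finset.mul_sum]
    exact Finset.sum_le_sum fun j _ => (h x x').isBR rfl i j
  | DP =>
    intro x x' _ S hS
    simp only [hM, weightMeasure_real_apply (h0 _) hS]
    rw [add_zero, Finset.mul_sum]
    exact Finset.sum_le_sum fun i _ => ((h x x').isDP rfl i).1

theorem Kind.IsPair.symm {k : Kind} {ι : Type*} [Fintype ι] {p q : ι → ℝ} (h : k.IsPair ε p q) :
    k.IsPair ε q p where
  nonneg_left := h.nonneg_right
  nonneg_right := h.nonneg_left
  sum_left := h.sum_right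
  sum_right := h.sum_left
  isBR hk i j := by
    have := h.isBR hk j i
    rwa [mul_comm (p j), mul_comm (p i)] at this
  isDP hk i := (h.isDP hk i).symm

/-- Needed because the extremal mechanism gives many inputs the same law. -/
theorem Kind.IsPair.refl_left {k : Kind} (hε : 0 ≤ ε) {ι : Type*} [Fintype ι] {p q : ι → ℝ}
    (h : k.IsPair ε p q) : k.IsPair ε p p where
  nonneg_left := h.nonneg_left
  nonneg_right := h.nonneg_left
  sum_left := h.sum_left
  sum_right := h.sum_left
  isBR _ i j := by
    rw [mul_comm (p j)]
    exact le_mul_of_one_le_left (mul_nonneg (h.nonneg_left i) (h.nonneg_left j))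
      (Real.one_le_exp hε)
  isDP _ i := by
    have := le_mul_of_one_le_left (h.nonneg_left i) (Real.one_le_exp hε)
    exact ⟨this, this⟩

open scoped Classical in
/-- The extension by zero of a family of weights on the fibre over `y` to a sigma type. -/
noncomputable def extendWeight {Y : Type*} {n : Y → ℕ} (p : ∀ y, Fin (n y) → ℝ) (y : Y)
    (z : Σ y, Fin (n y)) : ℝ :=
  if z.1 = y then p z.1 z.2 else 0

/-- A kernel has one target space, but the near-optimal pairs after different outcomes `y` have
different sizes. Padding with zeros costs nothing as `F 0 0 = 0`. -/
theorem sum_extendWeight {Y : Type*} [Fintype Y] {n : Y → ℕ} (p q : ∀ y, Fin (n y) → ℝ) (y : Y)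
    {F : ℝ → ℝ → ℝ} (hF : F 0 0 = 0) :
    ∑ z, F (extendWeight p y z) (extendWeight q y z) = ∑ i, F (p y i) (q y i) := by
  classical
  rw [Fintype.sum_sigma, Finset.sum_eq_single y]
  · simp [extendWeight]
  · intro y' _ hy'
    simp [extendWeight, hy', hF]
  · simp

theorem Kind.IsPair.extend {k : Kind} {Y : Type*} [Fintype Y] {n : Y → ℕ}
    {p q : ∀ y, Fin (n y) → ℝ} {y : Y} (h : k.IsPair ε (p y) (q y)) :
    k.IsPair ε (extendWeight p y) (extendWeight q y) where
  nonneg_left := by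
    rintro ⟨y', i⟩
    by_cases hy : y' = y
    · subst hy
      simpa [extendWeight] using h.nonneg_left i
    · simp [extendWeight, hy]
  nonneg_right := by
    rintro ⟨y', i⟩
    by_cases hy : y' = y
    · subst hy
      simpa [extendWeight] using h.nonneg_right i
    · simp [extendWeight, hy]
  sum_left := (sum_extendWeight p q y (F := fun a _ => a) rfl).trans h.sum_left
  sum_right := (sum_extendWeight p q y (F := fun _ b => b) rfl).trans h.sum_right
  isBR hk := by
    rintro ⟨y₁, i⟩ ⟨y₂, j⟩
    by_cases h₁ : y₁ = y
    · by_cases h₂ : y₂ = y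
      · subst h₁ h₂
        simpa [extendWeight] using h.isBR hk i j
      · simp [extendWeight, h₂]
    · simp [extendWeight, h₁]
  isDP hk := by
    rintro ⟨y', i⟩
    by_cases hy : y' = y
    · subst hy
      simpa [extendWeight] using h.isDP hk i
    · simp [extendWeight, hy]

theorem measureReal_compProd_singleton {Y Z : Type*} [MeasurableSpace Y] [MeasurableSpace Z]
    [MeasurableSingletonClass Y] [MeasurableSingletonClass Z] (P : Measure Y)
    [IsProbabilityMeasure P] (K : Kernel Y Z) [IsMarkovKernel K] (y : Y) (z : Z) :
    (P ⊗ₘ K).real {(y, z)} = P.real {y} * (K y).real {z} := by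
  rw [← Set.singleton_prod_singleton, measureReal_def, Measure.compProd_apply_prod
    (measurableSet_singleton y) (measurableSet_singleton z), lintegral_singleton,
    ENNReal.toReal_mul, mul_comm]
  rfl

/-- Suprema need not be attained, hence the slack `η`: half goes to the earlier rounds, half is
shared among the outcomes of the last one. -/
theorem exists_le_sum (hε : 0 ≤ ε) {g : ℝ} {x x' : X} (hx : x ≠ x')
    (L : List Kind) : ∀ {V : ℝ → ℝ → ℝ}, IsValue V → ∀ {η : ℝ}, 0 < η →
      ∃ M ∈ adaptiveSeq.{u, v} nbr ε L, ∃ (_ : Fintype M.Out) (_ : MeasurableSingletonClass M.Out),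
        listValue ε L V 1 g - η ≤ ∑ y, V ((M.law x).real {y}) (g * (M.law x').real {y}) := by
  induction L using List.reverseRecOn with
  | nil =>
    intro V hV η hη
    refine ⟨Mechanism.empty, rfl, inferInstanceAs (Fintype PUnit),
      inferInstanceAs (MeasurableSingletonClass PUnit), ?_⟩
    simp [listValue, measureReal_def, hη.le]
  | append_singleton L k ih =>
    intro V hV η hη
    obtain ⟨M, hM, _, _, hle⟩ := ih (hV.stepValue hε k) (half_pos hη)
    rw [listValue_append]
    have hd : 0 < η / 2 / (Fintype.card M.Out + 1) := by positivity
    choose n p q hpair hlt using fun y : M.Out => exists_lt_sum_of_lt_stepValue hε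
      (sub_lt_self (stepValue ε k V ((M.law x).real {y}) (g * (M.law x').real {y})) hd)
    classical
    let _ : MeasurableSpace (Σ y, Fin (n y)) := ⊤
    have hext : ∀ y, k.IsPair ε (extendWeight p y) (extendWeight q y) :=
      fun y => (hpair y).extend
    -- Only `x` against `x'` matters: `x` gets `p`, every other input gets `q`, so the constraint
    -- holds for all pairs of inputs.
    let w : X → M.Out → (Σ y, Fin (n y)) → ℝ := fun t =>
      if t = x then extendWeight p else extendWeight q
    have hwpair : ∀ y t t', k.IsPair ε (w t y) (w t' y) := by
      intro y t t'
      by_cases ht : t = x <;> by_cases ht' : t' = x <;> simp only [w, ht, ht', if_true, if_false]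
      · exact (hext y).refl_left hε
      · exact hext y
      · exact (hext y).symm
      · exact (hext y).symm.refl_left hε
    let K : X → Kernel M.Out (Σ y, Fin (n y)) := fun t =>
      ⟨fun y => weightMeasure (w t y), measurable_of_countable _⟩
    have hKm : ∀ t, IsMarkovKernel (K t) := fun t => ⟨fun y =>
      isProbabilityMeasure_weightMeasure (hwpair y t t).nonneg_left (hwpair y t t).sum_left⟩
    refine ⟨M.andThen K, ?_, inferInstanceAs (Fintype (M.Out × _)),
      inferInstanceAs (MeasurableSingletonClass (M.Out × _)), ?_⟩
    · rw [adaptiveSeq_concat]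
      refine ⟨M, hM, _, _, K, hKm, fun y => ?_, rfl⟩
      exact Kind.mem_mechanisms_of_isPair (Mechanism.atOutcome K y) (w := fun t => w t y)
        (fun t => rfl) (hwpair y)
    · have hK : ∀ t y z, (K t y).real {z} = w t y z := fun t y z =>
        weightMeasure_real_singleton (hwpair y t t).nonneg_left z
      have hwx : w x = extendWeight p := if_pos rfl
      have hwx' : w x' = extendWeight q := if_neg hx.symm
      have hsum : ∑ yz : M.Out × (Σ y, Fin (n y)), V ((M.law x ⊗ₘ K x).real {yz})
          (g * (M.law x' ⊗ₘ K x').real {yz}) =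
          ∑ y, ∑ i, V ((M.law x).real {y} * p y i) (g * (M.law x').real {y} * q y i) := by
        rw [Fintype.sum_prod_type]
        refine Finset.sum_congr rfl fun y _ => ?_
        rw [← sum_extendWeight p q y (F := fun a b => V ((M.law x).real {y} * a)
          (g * (M.law x').real {y} * b)) (by simp [hV.zero_zero])]
        refine Finset.sum_congr rfl fun z _ => ?_
        rw [measureReal_compProd_singleton, measureReal_compProd_singleton, hK, hK, hwx, hwx',
          mul_assoc g]
      refine le_trans ?_ hsum.ge
      have h1 := Finset.sum_le_sum fun y (_ : y ∈ Finset.univ) => (hlt y).le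
      rw [Finset.sum_sub_distrib, Finset.sum_const, nsmul_eq_mul, Finset.card_univ] at h1
      have h2 : Fintype.card M.Out * (η / 2 / (Fintype.card M.Out + 1)) ≤ η / 2 := by
        rw [← mul_div_assoc, div_le_iff₀ (by positivity)]
        nlinarith
      have h3 : listValue ε L (listValue ε [k] V) 1 g = listValue ε L (stepValue ε k V) 1 g := rfl
      linarith

/-! ### The optimal privacy parameter as a value -/

theorem deltaOpt_nonneg (M : Mechanism.{u, v} X) (εg : ℝ) : 0 ≤ deltaOpt nbr M εg :=
  Real.sInf_nonneg fun _ h => h.1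

theorem deltaOpt_le {M : Mechanism.{u, v} X} {εg δ : ℝ} (hδ : 0 ≤ δ) (h : IsDP nbr εg δ M) :
    deltaOpt nbr M εg ≤ δ :=
  csInf_le ⟨0, fun _ h => h.1⟩ ⟨hδ, h⟩

theorem isDP_one (M : Mechanism.{u, v} X) (εg : ℝ) : IsDP nbr εg 1 M := by
  intro x x' _ S _
  have h1 : (M.law x).real S ≤ 1 := measureReal_le_one
  have h2 : 0 ≤ Real.exp εg * (M.law x').real S := by positivity
  linarith

theorem deltaOptClass_le (hsymm : ∀ x x', nbr x x' → nbr x' x) (hε : 0 ≤ ε) (L : List Kind)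
    (εg : ℝ) : deltaOptClass nbr (adaptiveSeq.{u, v} nbr ε L) εg ≤
      listValue ε L (fun a b => max (a - b) 0) 1 (Real.exp εg) := by
  have h0 := (isValue_max.listValue hε L).nonneg 1 (Real.exp εg) zero_le_one (Real.exp_pos _).le
  refine Real.sSup_le ?_ h0
  rintro _ ⟨M, hM, rfl⟩
  refine deltaOpt_le h0 fun x x' hx S hS => ?_
  classical
  -- Observing only whether `S` occurs suffices: the cell of `S` carries the DP excess and the other
  -- cell is nonnegative.
  have h := sum_le_listValue hsymm hε (Real.exp_pos εg).le hx L isValue_max M hM Bool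
    (fun y => decide (y ∈ S)) (measurable_to_bool (by simpa [Set.preimage] using hS))
  have hS' : (fun y => decide (y ∈ S)) ⁻¹' {true} = S := by
    ext y
    simp
  rw [Fintype.sum_bool, hS'] at h
  have h1 := le_max_left ((M.law x).real S - Real.exp εg * (M.law x').real S) 0
  have h2 := le_max_right ((M.law x).real ((fun y => decide (y ∈ S)) ⁻¹' {false}) -
    Real.exp εg * (M.law x').real ((fun y => decide (y ∈ S)) ⁻¹' {false})) 0
  linarith

theorem le_deltaOptClass (hε : 0 ≤ ε) {x x' : X} (hnbr : nbr x x') (hx : x ≠ x') (L : List Kind)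
    (εg : ℝ) : listValue ε L (fun a b => max (a - b) 0) 1 (Real.exp εg) ≤
      deltaOptClass nbr (adaptiveSeq.{u, v} nbr ε L) εg := by
  refine le_of_forall_pos_le_add fun η hη => ?_
  obtain ⟨M, hM, _, _, hle⟩ :=
    exists_le_sum.{u, v} (nbr := nbr) hε hx L isValue_max hη
  have hM' : deltaOpt nbr M εg ≤ deltaOptClass nbr (adaptiveSeq.{u, v} nbr ε L) εg := by
    refine le_csSup ⟨1, ?_⟩ ⟨M, hM, rfl⟩
    rintro _ ⟨M, _, rfl⟩
    exact deltaOpt_le zero_le_one (isDP_one M εg)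
  refine sub_le_iff_le_add.1 (hle.trans (le_trans ?_ hM'))
  refine le_csInf ⟨1, zero_le_one, isDP_one M εg⟩ fun δ hδ => ?_
  classical
  -- The optimal event, on which the sum of differences equals the sum of positive parts.
  let S : Finset M.Out :=
    Finset.univ.filter fun y => 0 ≤ (M.law x).real {y} - Real.exp εg * (M.law x').real {y}
  have h := hδ.2 x x' hnbr S S.measurableSet
  rw [← sum_measureReal_singleton, ← sum_measureReal_singleton, Finset.mul_sum,
    ← sub_le_iff_le_add', ← Finset.sum_sub_distrib, Finset.sum_filter] at h
  refine le_trans (le_of_eq (Finset.sum_congr rfl fun y _ => ?_)) h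
  split_ifs with hy
  · exact max_eq_left hy
  · exact max_eq_right (not_le.1 hy).le

/-- The lower bound needs two distinct neighbours. Without them every mechanism is `(εg, 0)`-DP, as
`exp εg ≥ 1`, and the left side is at most `0`. -/
theorem deltaOptClass_mono_of_listValue_le (hsymm : ∀ x x', nbr x x' → nbr x' x) (hε : 0 ≤ ε)
    {εg : ℝ} (hεg : 0 ≤ εg) {L L' : List Kind}
    (h : listValue ε L (fun a b => max (a - b) 0) 1 (Real.exp εg) ≤
      listValue ε L' (fun a b => max (a - b) 0) 1 (Real.exp εg)) :
    deltaOptClass nbr (adaptiveSeq.{u, v} nbr ε L) εg ≤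
      deltaOptClass nbr (adaptiveSeq.{u, v} nbr ε L') εg := by
  by_cases hx : ∃ x x', nbr x x' ∧ x ≠ x'
  · obtain ⟨x, x', hnbr, hne⟩ := hx
    exact (deltaOptClass_le hsymm hε L εg).trans (h.trans (le_deltaOptClass hε hnbr hne L' εg))
  · push Not at hx
    have h0 : 0 ≤ deltaOptClass nbr (adaptiveSeq.{u, v} nbr ε L') εg := by
      refine Real.sSup_nonneg ?_
      rintro _ ⟨M, _, rfl⟩
      exact deltaOpt_nonneg M εg
    refine Real.sSup_le ?_ h0
    rintro _ ⟨M, _, rfl⟩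
    refine (deltaOpt_le le_rfl fun x x' hnbr S _ => ?_).trans h0
    rw [hx x x' hnbr, add_zero]
    exact le_mul_of_one_le_left measureReal_nonneg (Real.one_le_exp hεg)

end PrivacyOrdering

theorem mainTheorem4 {X : Type u} (nbr : X → X → Prop) (hsymm : ∀ x x', nbr x x' → nbr x' x)
    (ε : ℝ) (hε : 0 < ε) (εg : ℝ) (hεg : 0 ≤ εg) :
    (∀ L L' : List PrivacyOrdering.Kind,
      PrivacyOrdering.deltaOptClass nbr
          (PrivacyOrdering.adaptiveSeq.{u, v} nbr ε
            (L ++ [PrivacyOrdering.Kind.BR, PrivacyOrdering.Kind.DP] ++ L')) εg ≤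
        PrivacyOrdering.deltaOptClass nbr
          (PrivacyOrdering.adaptiveSeq.{u, v} nbr ε
            (L ++ [PrivacyOrdering.Kind.DP, PrivacyOrdering.Kind.BR] ++ L')) εg) ∧
    (∀ (m n : ℕ) (L : List PrivacyOrdering.Kind),
      L.Perm (List.replicate m PrivacyOrdering.Kind.DP ++
        List.replicate n PrivacyOrdering.Kind.BR) →
      PrivacyOrdering.deltaOptClass nbr (PrivacyOrdering.adaptiveSeq.{u, v} nbr ε L) εg ≤
        PrivacyOrdering.deltaOptClass nbr
          (PrivacyOrdering.adaptiveSeq.{u, v} nbr ε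
            (List.replicate m PrivacyOrdering.Kind.DP ++
              List.replicate n PrivacyOrdering.Kind.BR)) εg) := by
  have hg := (Real.exp_pos εg).le
  exact ⟨fun L L' => PrivacyOrdering.deltaOptClass_mono_of_listValue_le hsymm hε.le hεg
      (PrivacyOrdering.listValue_BR_DP_le hε PrivacyOrdering.isValue_max L L' zero_le_one hg),
    fun m n L hL => PrivacyOrdering.deltaOptClass_mono_of_listValue_le hsymm hε.le hεg
      (PrivacyOrdering.listValue_le_sorted hε PrivacyOrdering.isValue_max hL 1 _ zero_le_one hg)⟩
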